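/- Let $\mathbb{M}$ be a Minkowski space, i.e. a finite-dimensional real normed space $(V,\|\cdot\|)$, with dual norm $\|\cdot\|^*$ on the dual space $V^*$. For $x\in V\setminus\{0\}$ let $$\partial x=\{\varphi\in V^*:\ \|\varphi\|^*=1,\ \varphi(x)=\|x\|\}$$ be the set of norming functionals of $x$, and for $C,D\subseteq V^*$ let $$C\boxplus D=\{\varphi+\psi:\ \varphi\in C,\ \psi\in D,\ \|\varphi+\psi\|^*\le 1\}$$ be the reduced Minkowski sum. A parenthesization of a finite non-empty family $(A_i)_{i\in I}$ of subsets of $V^*$ is defined recursively: $A_i$ is the only parenthesization of the one-member family $(A_i)_{i\in\{i\}}$, and if $I$ is the disjoint union of non-empty sets $I_1,I_2$ and $\langle\Sigma_j\rangle$ is a parenthesization of $(A_i)_{i\in I_j}$ for $j=1,2$, then $\langle\Sigma_1\rangle\boxplus\langle\Sigma_2\rangle$ is a parenthesization of $(A_i)_{i\in I}$. (The family with $I=\emptyset$ has no parenthesizations.) A Steiner tree of a finite set $N\subseteq V$ is a tree whose vertex set is a finite subset of $V$ that contains $N$; its length is the sum of $\|x-y\|$ over its edges $xy$; a Steiner minimal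 tree (SMT) of $N$ is a Steiner tree of $N$ of minimum length. **Theorem.** Let $k\ge 0$ and let $p_0,p_1,\dots,p_k$ be distinct points of $V$. Then the star joining $p_0$ to each of $p_1,\dots,p_k$ is an SMT of $\{p_0,p_1,\dots,p_k\}$ if and only if every parenthesization of the family $\big(\partial(p_i-p_0)\big)_{i=1}^k$ is non-empty. -/

import Mathlib

/-- The length `‖x - y‖` of an edge `xy` of a graph whose vertices are points of `E`. -/
noncomputable def edgeLength {E : Type*} [NormedAddCommGroup E] {V : Finset E} : Sym2 V → ℝ :=
  Sym2.lift ⟨fun x y => ‖(x : E) - (y : E)‖, fun x y => norm_sub_rev (x : E) (y : E)⟩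

/-- A Steiner tree of a finite set `N` of points of `E`: a tree whose vertex set is a finite
set of points of `E` containing `N`. -/
structure SteinerTree {E : Type*} (N : Finset E) where
  /-- The vertices: nodes and Steiner points. -/
  verts : Finset E
  /-- The edges. -/
  graph : SimpleGraph verts
  isTree : graph.IsTree
  subset_verts : N ⊆ verts

open Classical in
/-- The length of a Steiner tree: the sum of the lengths of its edges. -/
noncomputable def SteinerTree.length {E : Type*} [NormedAddCommGroup E] {N : Finset E}
    (T : SteinerTree N) : ℝ :=
  ∑ e ∈ T.graph.edgeFinset, edgeLength e

/-- A Steiner minimal tree (SMT) of `N`: a Steiner tree of `N` of minimum length. -/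
def SteinerTree.IsMinimal {E : Type*} [NormedAddCommGroup E] {N : Finset E}
    (T : SteinerTree N) : Prop :=
  ∀ T' : SteinerTree N, T.length ≤ T'.length

/-- The star with vertex set `N` that joins the point `c` of `N` to all other points of `N`. -/
def SteinerTree.star {E : Type*} (N : Finset E) (c : E) (hc : c ∈ N) : SteinerTree N where
  verts := N
  graph := SimpleGraph.starGraph ⟨c, hc⟩
  isTree := SimpleGraph.isTree_starGraph _
  subset_verts := Finset.Subset.refl N

open Classical in
/-- The set `∂x` of norming functionals of `x`: the functionals `φ` of dual norm `1` with
`φ x = ‖x‖` if `x ≠ 0`, and the whole dual unit ball if `x = 0`. -/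
noncomputable def normingFunctionals {E : Type*} [NormedAddCommGroup E] [NormedSpace ℝ E]
    (x : E) : Set (StrongDual ℝ E) :=
  if x = 0 then Metric.closedBall 0 1 else {φ | ‖φ‖ = 1 ∧ φ x = ‖x‖}

/-- The reduced Minkowski sum `C ⊞ D` of two sets of functionals: their Minkowski sum
intersected with the dual unit ball. -/
def reducedSum {E : Type*} [NormedAddCommGroup E] [NormedSpace ℝ E]
    (C D : Set (StrongDual ℝ E)) : Set (StrongDual ℝ E) :=
  {χ | (∃ φ ∈ C, ∃ ψ ∈ D, φ + ψ = χ) ∧ ‖χ‖ ≤ 1}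

/-- Parenthesizations of a family indexed by a finite set `I` of indices (in any order, each
index used exactly once), as formal expressions. There is none for `I = ∅`. -/
inductive Parenthesization {ι : Type*} : Finset ι → Type _
  | operand (i : ι) : Parenthesization {i}
  | add {I J : Finset ι} (h : Disjoint I J) (a : Parenthesization I) (b : Parenthesization J) :
      Parenthesization (I.disjUnion J h)

/-- The set to which a parenthesization of the family `A` evaluates, every binary operation
being read as reduced Minkowski addition. -/
def Parenthesization.eval {ι : Type*} {E : Type*} [NormedAddCommGroup E] [NormedSpace ℝ E]
    (A : ι → Set (StrongDual ℝ E)) {I : Finset ι} : Parenthesization I → Set (StrongDual ℝ E)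
  | operand i => A i
  | add _ a b => reducedSum (a.eval A) (b.eval A)

/-! Put `p 0` at the origin, with terminals `x i`. For a parenthesization `P` let f_P(y) be the
infimal length of a network of shape `P` joining the `x i` to the root y. If `P` is a single
operand, f_P(y) = ‖x i - y‖; for a sum of `P` and `Q`, it is the infimal convolution of f_P + f_Q
with the norm. So f_P is convex and 1-Lipschitz, and f_P(0) is at most the star length L = ∑ ‖x i‖.
The value of `P` is exactly the set of χ with f_P(y) ≥ L - χ(y) for all y: a sum of functions splits
χ (`exists_add_eq_of_forall_sub_le`, by Hahn-Banach), and convolution with the norm imposes ‖χ‖ ≤ 1.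
Such a χ exists iff f_P(0) = L, that is, iff no network of shape `P` beats the star. It remains to
match shapes with trees: a network of shape `P` contains a Steiner tree, and a Steiner tree, folded
towards its root, is a network of some shape (`SteinerTree.joins`). -/

namespace Parenthesization

/-! ### Networks of a prescribed shape. -/

variable {ι E : Type*} [NormedAddCommGroup E]

/-- `P.Connects x y t` says that the points `x i` and the root `y` can be joined by a network of
length at most `t` whose shape is prescribed by `P`: every sum in `P` is a branching point. -/
def Connects (x : ι → E) {I : Finset ι} : Parenthesization I → E → ℝ → Prop
  | operand i, y, t => ‖x i - y‖ ≤ t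
  | add _ a b, y, t =>
      ∃ s t₁ t₂, a.Connects x s t₁ ∧ b.Connects x s t₂ ∧ t₁ + t₂ + ‖s - y‖ ≤ t

/-- The root edge absorbs the displacement by the triangle inequality. This is the 1-Lipschitz
property of f_P that the sum rule requires. -/
theorem Connects.move {x : ι → E} {I : Finset ι} {P : Parenthesization I} {y : E} {t : ℝ}
    (h : P.Connects x y t) (z : E) {t' : ℝ} (ht : t + ‖y - z‖ ≤ t') : P.Connects x z t' := by
  cases P with
  | operand i =>
    simp only [Connects] at h ⊢
    linarith [norm_sub_le_norm_sub_add_norm_sub (x i) y z]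
  | add _ a b =>
    obtain ⟨s, t₁, t₂, h₁, h₂, hle⟩ := h
    exact ⟨s, t₁, t₂, h₁, h₂, by linarith [norm_sub_le_norm_sub_add_norm_sub s y z]⟩

theorem Connects.mono {x : ι → E} {I : Finset ι} {P : Parenthesization I} {y : E} {t t' : ℝ}
    (h : P.Connects x y t) (ht : t ≤ t') : P.Connects x y t' :=
  h.move y (by simpa using ht)

/-- The star is a degenerate network of every shape. -/
theorem connects_zero (x : ι → E) {I : Finset ι} (P : Parenthesization I) :
    P.Connects x 0 (∑ i ∈ I, ‖x i‖) := by
  induction P with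
  | operand i => simp [Connects]
  | add h a b iha ihb =>
    exact ⟨0, _, _, iha, ihb, by simp [Finset.sum_disjUnion]⟩

variable [NormedSpace ℝ E]

/-- Convex combinations of the branching points again form a network, and the norm is convex. -/
theorem convex_connects (x : ι → E) {I : Finset ι} (P : Parenthesization I) :
    Convex ℝ {q : E × ℝ | P.Connects x q.1 q.2} := by
  induction P with
  | operand i =>
    rintro ⟨y, t⟩ h ⟨y', t'⟩ h' a b ha hb hab
    simp only [Connects, Set.mem_ofPred_eq, Prod.fst_add, Prod.snd_add, Prod.smul_fst,
      Prod.smul_snd, smul_eq_mul] at h h' ⊢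
    have e : x i - (a • y + b • y') = a • (x i - y) + b • (x i - y') := by
      rw [smul_sub, smul_sub, sub_add_sub_comm, ← add_smul, hab, one_smul]
    rw [e]
    refine (norm_add_le _ _).trans ?_
    rw [norm_smul_of_nonneg ha, norm_smul_of_nonneg hb]
    gcongr
  | add hd P Q ihP ihQ =>
    rintro ⟨y, t⟩ ⟨s, t₁, t₂, h₁, h₂, h⟩ ⟨y', t'⟩ ⟨s', t₁', t₂', h₁', h₂', h'⟩ a b ha hb hab
    have h₁ := @ihP (s, t₁) h₁ (s', t₁') h₁' a b ha hb hab
    have h₂ := @ihQ (s, t₂) h₂ (s', t₂') h₂' a b ha hb hab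
    refine ⟨a • s + b • s', a * t₁ + b * t₁', a * t₂ + b * t₂', h₁, h₂, ?_⟩
    simp only [Prod.fst_add, Prod.snd_add, Prod.smul_fst, Prod.smul_snd, smul_eq_mul] at h h' ⊢
    have e : a • s + b • s' - (a • y + b • y') = a • (s - y) + b • (s' - y') := by
      simp only [smul_sub]; abel
    have hn : ‖a • s + b • s' - (a • y + b • y')‖ ≤ a * ‖s - y‖ + b * ‖s' - y'‖ := by
      rw [e, ← norm_smul_of_nonneg ha, ← norm_smul_of_nonneg hb]
      exact norm_add_le _ _
    nlinarith [mul_le_mul_of_nonneg_left h ha, mul_le_mul_of_nonneg_left h' hb]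

end Parenthesization

/-! ### Subgradients and their sum rule. -/

section Duality

variable {E : Type*} [NormedAddCommGroup E] [NormedSpace ℝ E]

theorem StrongDual.norm_le_one_of_le_norm {φ : StrongDual ℝ E} (h : ∀ z, φ z ≤ ‖z‖) : ‖φ‖ ≤ 1 :=
  φ.opNorm_le_bound zero_le_one fun z => by
    rw [one_mul, Real.norm_eq_abs, abs_le']
    exact ⟨h z, by simpa using h (-z)⟩

/-- Recasts norming as a subgradient inequality at 0 for y ↦ ‖x - y‖. For the converse, y = -z
bounds φ by the norm and y = x gives φ x = ‖x‖. -/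
theorem mem_normingFunctionals_iff {x : E} (hx : x ≠ 0) {φ : StrongDual ℝ E} :
    φ ∈ normingFunctionals x ↔ ∀ y, ‖x‖ - φ y ≤ ‖x - y‖ := by
  rw [normingFunctionals, if_neg hx, Set.mem_ofPred_eq]
  constructor
  · rintro ⟨h₁, h₂⟩ y
    have := (le_abs_self _).trans (φ.le_opNorm (x - y))
    rw [h₁, one_mul, map_sub, h₂] at this
    exact this
  · intro h
    have hle : ∀ z, φ z ≤ ‖z‖ := fun z => by
      have h₁ := h (-z)
      rw [map_neg, sub_neg_eq_add, sub_neg_eq_add] at h₁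
      linarith [norm_add_le x z]
    have hn : ‖φ‖ ≤ 1 := StrongDual.norm_le_one_of_le_norm hle
    have hφ : φ x = ‖x‖ := le_antisymm (hle x) (by simpa using h x)
    refine ⟨le_antisymm hn ?_, hφ⟩
    have := (le_abs_self _).trans (φ.le_opNorm x)
    rw [hφ] at this
    exact le_of_mul_le_mul_right (by simpa using this) (norm_pos_iff.2 hx)

/-- The sum rule for subgradients at `0` of two convex functions given by their epigraphs `A`
and `B`, the first function being `1`-Lipschitz. -/
theorem exists_add_eq_of_forall_sub_le {A B : Set (E × ℝ)} (hA : Convex ℝ A) (hB : Convex ℝ B)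
    {a b : ℝ} (hA₀ : ((0 : E), a) ∈ A) (hB₀ : ((0 : E), b) ∈ B)
    (hLip : ∀ y t, (y, t) ∈ A → ∀ z t', t + ‖y - z‖ ≤ t' → (z, t') ∈ A)
    (φ : StrongDual ℝ E)
    (h : ∀ y t₁ t₂, (y, t₁) ∈ A → (y, t₂) ∈ B → a + b - φ y ≤ t₁ + t₂) :
    ∃ φ₁ φ₂ : StrongDual ℝ E, φ₁ + φ₂ = φ ∧ (∀ y t, (y, t) ∈ A → a - φ₁ y ≤ t) ∧
      ∀ y t, (y, t) ∈ B → b - φ₂ y ≤ t := by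
  -- `A'` is the strict epigraph of the first function, open by the Lipschitz condition; `B'` is the
  -- hypograph of a + b - φ minus the second. The hypothesis makes them disjoint.
  let A' : Set (E × ℝ) := {q | ∃ t < q.2, (q.1, t) ∈ A}
  let B' : Set (E × ℝ) := {q | (q.1, a + b - φ q.1 - q.2) ∈ B}
  have hA' : Convex ℝ A' := by
    rintro ⟨y, r⟩ ⟨t, ht, hy⟩ ⟨y', r'⟩ ⟨t', ht', hy'⟩ α β hα hβ hαβ
    refine ⟨α * t + β * t', ?_, hA hy hy' hα hβ hαβ⟩
    simp only [Prod.snd_add, Prod.smul_snd, smul_eq_mul] at ht ht' ⊢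
    rcases hα.eq_or_lt with rfl | hα
    · obtain rfl : β = 1 := by linarith
      linarith
    · linarith [mul_lt_mul_of_pos_left ht hα, mul_le_mul_of_nonneg_left ht'.le hβ]
  have hO : IsOpen A' := by
    rw [Metric.isOpen_iff]
    rintro ⟨y, r⟩ ⟨t, ht, hy⟩
    simp only at ht hy
    refine ⟨(r - t) / 2, by linarith, ?_⟩
    rintro ⟨z, r'⟩ hz
    rw [Metric.mem_ball, Prod.dist_eq, max_lt_iff] at hz
    obtain ⟨hz₁, hz₂⟩ := hz
    simp only [dist_eq_norm, Real.norm_eq_abs] at hz₁ hz₂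
    rw [norm_sub_rev] at hz₁
    exact ⟨t + ‖y - z‖, by simp only; linarith [(abs_lt.1 hz₂).1], hLip y t hy z _ le_rfl⟩
  have hB' : Convex ℝ B' := by
    rintro ⟨y, r⟩ hy ⟨y', r'⟩ hy' α β hα hβ hαβ
    have := hB hy hy' hα hβ hαβ
    simp only [B', Set.mem_ofPred_eq, Prod.smul_mk, Prod.mk_add_mk, smul_eq_mul, map_add,
      map_smul] at this ⊢
    convert this using 2
    linear_combination (-(a + b)) * hαβ
  have hdisj : Disjoint A' B' := by
    rw [Set.disjoint_left]
    rintro ⟨y, r⟩ ⟨t, ht, hy⟩ hy'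
    have := h y t _ hy hy'
    simp only at ht this
    linarith
  obtain ⟨f, u, hf₁, hf₂⟩ := geometric_hahn_banach_open hA' hO hB' hdisj
  set α : ℝ := f (0, 1) with hα
  have hf : ∀ y t, f (y, t) = f (y, 0) + α * t := fun y t => by
    have : (y, t) = (y, (0 : ℝ)) + t • ((0 : E), (1 : ℝ)) := by simp
    rw [this, map_add, map_smul, smul_eq_mul, mul_comm, ← hα]
  have hf0 : ∀ t, f (0, t) = α * t := fun t => by
    rw [hf, show ((0 : E), (0 : ℝ)) = 0 from rfl, map_zero, zero_add]
  have hB'₀ : f (0, a) ≥ u := hf₂ (0, a) (by simpa [B'] using hB₀)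
  -- The separating hyperplane is not vertical: (0, a + 1) lies in `A'` and (0, a) in `B'`.
  have hαneg : α < 0 := by
    have := hf₁ (0, a + 1) ⟨a, by simp, hA₀⟩
    rw [hf0] at this hB'₀
    linarith
  have hA₁ : ∀ y t, (y, t) ∈ A → f (y, t) ≤ u := fun y t hy => by
    refine le_of_forall_pos_le_add fun ε hε => ?_
    have := hf₁ (y, t + ε / (-α)) ⟨t, by simp only; linarith [div_pos hε (neg_pos.2 hαneg)], hy⟩
    rw [hf, mul_add] at this
    rw [hf]
    have e : α * (ε / -α) = -ε := by rw [div_neg, mul_neg, mul_div_cancel₀ _ hαneg.ne]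
    linarith
  have hu : u = α * a := by
    rw [hf0] at hB'₀
    exact le_antisymm hB'₀ ((hf0 a) ▸ hA₁ 0 a hA₀)
  let φ₁ : StrongDual ℝ E := α⁻¹ • f.comp (ContinuousLinearMap.inl ℝ E ℝ)
  have hφ₁ : ∀ y, α * φ₁ y = f (y, 0) := fun y => by
    simp [φ₁, mul_inv_cancel_left₀ hαneg.ne]
  refine ⟨φ₁, φ - φ₁, by abel, fun y t hy => ?_, fun y t hy => ?_⟩
  · have := hA₁ y t hy
    rw [hf, ← hφ₁, hu, ← mul_add] at this
    linarith [(mul_le_mul_left_of_neg hαneg).1 this]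
  · have := hf₂ (y, a + b - φ y - t) (by simpa [B'] using hy)
    rw [hf, ← hφ₁, hu, ← mul_add] at this
    have := (mul_le_mul_left_of_neg hαneg).1 this
    rw [sub_apply]
    linarith

end Duality

/-! ### Parenthesizations as sets of subgradients. -/

namespace Parenthesization

variable {ι E : Type*} [NormedAddCommGroup E] [NormedSpace ℝ E]

/-- The functionals in a parenthesization bound the length of networks from below. -/
theorem Connects.sub_le {x : ι → E} (hx : ∀ i, x i ≠ 0) {I : Finset ι} {P : Parenthesization I}
    {χ : StrongDual ℝ E} (hχ : χ ∈ P.eval fun i => normingFunctionals (x i)) {y : E} {t : ℝ}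
    (h : P.Connects x y t) : ∑ i ∈ I, ‖x i‖ - χ y ≤ t := by
  induction P generalizing χ y t with
  | operand i =>
    rw [Finset.sum_singleton]
    exact ((mem_normingFunctionals_iff (hx i)).1 hχ y).trans h
  | add hd P Q ihP ihQ =>
    obtain ⟨⟨φ, hφ, ψ, hψ, rfl⟩, hn⟩ := hχ
    obtain ⟨s, t₁, t₂, h₁, h₂, hle⟩ := h
    rw [Finset.sum_disjUnion]
    have h₁ := ihP hφ h₁
    have h₂ := ihQ hψ h₂
    have h₃ := (le_abs_self _).trans ((φ + ψ).le_of_opNorm_le hn (s - y))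
    rw [map_sub, one_mul] at h₃
    simp only [add_apply] at h₃ ⊢
    linarith

/-- Converse of `Connects.sub_le`. Putting the branching point at the root reduces a sum to the sum
rule. -/
theorem mem_eval_of_forall_connects {x : ι → E} (hx : ∀ i, x i ≠ 0) {I : Finset ι}
    (P : Parenthesization I) {χ : StrongDual ℝ E}
    (h : ∀ y t, P.Connects x y t → ∑ i ∈ I, ‖x i‖ - χ y ≤ t) :
    χ ∈ P.eval fun i => normingFunctionals (x i) := by
  induction P generalizing χ with
  | operand i =>
    refine (mem_normingFunctionals_iff (hx i)).2 fun y => ?_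
    simpa using h y _ le_rfl
  | add hd P Q ihP ihQ =>
    rw [Finset.sum_disjUnion] at h
    obtain ⟨φ, ψ, hadd, h₁, h₂⟩ := exists_add_eq_of_forall_sub_le (P.convex_connects x)
      (Q.convex_connects x) (P.connects_zero x) (Q.connects_zero x)
      (fun y t hy z t' ht => hy.move z ht) χ
      (fun y t₁ t₂ hy₁ hy₂ => h y _ ⟨y, t₁, t₂, hy₁, hy₂, by simp⟩)
    refine ⟨⟨φ, ihP h₁, ψ, ihQ h₂, hadd⟩, StrongDual.norm_le_one_of_le_norm fun z => ?_⟩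
    -- The star with one extra edge from 0 to -z gives χ z ≤ ‖z‖.
    have := h (-z) _ ⟨0, _, _, P.connects_zero x, Q.connects_zero x, le_rfl⟩
    simp only [map_neg, zero_sub, neg_neg] at this
    linarith

/-- By the Lipschitz property, f_P(y) + ‖y‖ is minimal at y = 0. The sum rule, applied to the
functional 0, then extracts a subgradient of f_P. -/
theorem eval_nonempty_of_forall_connects {x : ι → E} (hx : ∀ i, x i ≠ 0) {I : Finset ι}
    (P : Parenthesization I) (h : ∀ t, P.Connects x 0 t → ∑ i ∈ I, ‖x i‖ ≤ t) :
    (P.eval fun i => normingFunctionals (x i)).Nonempty := by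
  obtain ⟨φ, -, -, h₁, -⟩ := exists_add_eq_of_forall_sub_le (P.convex_connects x)
    (convexOn_univ_norm (E := E)).convex_epigraph (P.connects_zero x) (b := 0) (by simp)
    (fun y t hy z t' ht => hy.move z ht) 0
    (fun y t₁ t₂ hy₁ hy₂ => by
      have := h _ (Connects.move hy₁ 0 le_rfl)
      rw [sub_zero] at this
      rw [zero_apply, sub_zero, add_zero]
      exact this.trans (add_le_add_right hy₂.2 t₁))
  exact ⟨φ, P.mem_eval_of_forall_connects hx h₁⟩

end Parenthesization

/-! ### Passing between Steiner trees and networks of some shape. -/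

section Networks

variable {E : Type*} [NormedAddCommGroup E]

/-- The distance between the two points of an unordered pair. -/
noncomputable def pairLength : Sym2 E → ℝ :=
  Sym2.lift ⟨fun x y => ‖x - y‖, fun x y => norm_sub_rev x y⟩

@[simp]
theorem pairLength_mk (x y : E) : pairLength s(x, y) = ‖x - y‖ := rfl

theorem pairLength_nonneg (e : Sym2 E) : 0 ≤ pairLength e := by
  induction e with
  | _ x y => simp

theorem edgeLength_eq_pairLength_map {V : Finset E} (e : Sym2 V) :
    edgeLength e = pairLength (e.map Subtype.val) := by
  induction e with | _ x y => rfl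

theorem edgeLength_nonneg {V : Finset E} (e : Sym2 V) : 0 ≤ edgeLength e := by
  rw [edgeLength_eq_pairLength_map]
  exact pairLength_nonneg _

theorem SteinerTree.length_eq_sum {N : Finset E} (T : SteinerTree N) {S : Finset (Sym2 T.verts)}
    (hS : ∀ e, e ∈ S ↔ e ∈ T.graph.edgeSet) : T.length = ∑ e ∈ S, edgeLength e := by
  classical
  rw [SteinerTree.length]
  congr 1
  ext e
  exact SimpleGraph.mem_edgeFinset.trans (hS e).symm

theorem SteinerTree.length_le_sum_pairLength {N : Finset E} (T : SteinerTree N)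
    {F : Finset (Sym2 E)} (hF : ∀ v w, T.graph.Adj v w → s((v : E), (w : E)) ∈ F) :
    T.length ≤ ∑ e ∈ F, pairLength e := by
  classical
  simp only [SteinerTree.length, edgeLength_eq_pairLength_map]
  rw [← Finset.sum_image (f := pairLength) (g := Sym2.map (Subtype.val : T.verts → E))
    fun _ _ _ _ h => Sym2.map.injective Subtype.val_injective h]
  refine Finset.sum_le_sum_of_subset_of_nonneg (fun e he => ?_) fun e _ _ => pairLength_nonneg e
  obtain ⟨e, he', rfl⟩ := Finset.mem_image.1 he
  clear he
  induction e with
  | _ v w => exact hF v w (SimpleGraph.mem_edgeSet _ |>.1 (SimpleGraph.mem_edgeFinset.1 he'))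

/-- A finite network that connects `r` to all points of `N` contains a Steiner tree of `N`. -/
theorem exists_steinerTree_length_le (F : Finset (Sym2 E)) {N : Finset E} (r : E)
    (h : ∀ v ∈ N, (SimpleGraph.fromEdgeSet (F : Set (Sym2 E))).Reachable r v) :
    ∃ T : SteinerTree N, T.length ≤ ∑ e ∈ F, pairLength e := by
  classical
  set G := SimpleGraph.fromEdgeSet (F : Set (Sym2 E)) with hG
  let C := G.connectedComponentMk r
  have hmem : ∀ v, v ∈ C.supp ↔ G.Reachable v r := fun v => SimpleGraph.ConnectedComponent.eq
  -- Apart from `r`, every vertex of the component is an endpoint of a member of `F`.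
  have hfin : C.supp.Finite := by
    refine (insert r (F.biUnion Sym2.toFinset)).finite_toSet.subset fun v hv => ?_
    obtain ⟨w⟩ := (hmem v).1 hv
    cases w with
    | nil => simp
    | cons hadj _ =>
      rw [hG, SimpleGraph.fromEdgeSet_adj] at hadj
      refine Finset.mem_coe.2 (Finset.mem_insert_of_mem (Finset.mem_biUnion.2 ⟨_, hadj.1, ?_⟩))
      simp
  have hconn : (G.induce (hfin.toFinset : Set E)).Connected := by
    rw [hfin.coe_toFinset]
    exact (SimpleGraph.ConnectedComponent.maximal_connected_induce_supp C).prop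
  obtain ⟨T, hT, htree⟩ := hconn.exists_isTree_le
  refine ⟨⟨hfin.toFinset, T, htree, fun v hv => hfin.mem_toFinset.2 ((hmem v).2 (h v hv).symm)⟩,
    SteinerTree.length_le_sum_pairLength _ fun v w hadj => ?_⟩
  exact ((SimpleGraph.fromEdgeSet_adj _).1 (hT hadj)).1

/-- The edges are collected in a set, so coinciding edges count once and the length can only drop;
degenerate edges have length 0. -/
theorem Parenthesization.Connects.exists_reachable {ι : Type*} {x : ι → E} {I : Finset ι}
    {P : Parenthesization I} {y : E} {t : ℝ} (h : P.Connects x y t) (o : E) :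
    ∃ F : Finset (Sym2 E), (∀ i ∈ I,
      (SimpleGraph.fromEdgeSet (F : Set (Sym2 E))).Reachable (o + y) (o + x i)) ∧
      ∑ e ∈ F, pairLength e ≤ t := by
  classical
  have hedge : ∀ {F : Finset (Sym2 E)} {v w : E}, s(v, w) ∈ F →
      (SimpleGraph.fromEdgeSet (F : Set (Sym2 E))).Reachable v w := fun {F v w} hF => by
    rcases eq_or_ne v w with rfl | hne
    · rfl
    · exact SimpleGraph.Adj.reachable ((SimpleGraph.fromEdgeSet_adj _).2 ⟨hF, hne⟩)
  induction P generalizing y t with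
  | operand i =>
    refine ⟨{s(o + y, o + x i)}, fun j hj => ?_, ?_⟩
    · rw [Finset.mem_singleton.1 hj]
      exact hedge (Finset.mem_singleton_self _)
    · rw [Finset.sum_singleton, pairLength_mk, add_sub_add_left_eq_sub, norm_sub_rev]
      exact h
  | @add I J hd P Q ihP ihQ =>
    obtain ⟨s, t₁, t₂, h₁, h₂, hle⟩ := h
    obtain ⟨F₁, hF₁, hl₁⟩ := ihP h₁
    obtain ⟨F₂, hF₂, hl₂⟩ := ihQ h₂
    refine ⟨insert s(o + y, o + s) (F₁ ∪ F₂), fun j hj => ?_, ?_⟩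
    · refine (hedge (Finset.mem_insert_self _ _)).trans ?_
      rcases Finset.mem_disjUnion.1 hj with hj | hj
      · refine (hF₁ j hj).mono (SimpleGraph.fromEdgeSet_mono (Finset.coe_subset.2 ?_))
        exact Finset.subset_union_left.trans (Finset.subset_insert _ _)
      · refine (hF₂ j hj).mono (SimpleGraph.fromEdgeSet_mono (Finset.coe_subset.2 ?_))
        exact Finset.subset_union_right.trans (Finset.subset_insert _ _)
    · have hins : ∑ e ∈ insert s(o + y, o + s) (F₁ ∪ F₂), pairLength e ≤
          ‖s - y‖ + ∑ e ∈ F₁ ∪ F₂, pairLength e := by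
        by_cases hm : s(o + y, o + s) ∈ F₁ ∪ F₂
        · rw [Finset.insert_eq_of_mem hm]
          linarith [norm_nonneg (s - y)]
        · rw [Finset.sum_insert hm, pairLength_mk, add_sub_add_left_eq_sub, norm_sub_rev]
      have hunion := Finset.sum_union_inter (s₁ := F₁) (s₂ := F₂) (f := pairLength)
      have hinter := Finset.sum_nonneg fun e (_ : e ∈ F₁ ∩ F₂) => pairLength_nonneg e
      linarith

/-- The points `x i` with `i ∈ I`, possibly none, and the root `y` can be joined by a network of
length at most `t` of some shape. -/
def Joins {ι : Type*} (x : ι → E) (I : Finset ι) (y : E) (t : ℝ) : Prop :=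
  (I = ∅ ∧ 0 ≤ t) ∨ ∃ P : Parenthesization I, P.Connects x y t

theorem Joins.move {ι : Type*} {x : ι → E} {I : Finset ι} {y : E} {t : ℝ} (h : Joins x I y t)
    (z : E) : Joins x I z (t + ‖y - z‖) := by
  rcases h with ⟨hI, ht⟩ | ⟨P, hP⟩
  · exact .inl ⟨hI, by positivity⟩
  · exact .inr ⟨P, hP.move z le_rfl⟩

theorem Joins.mono {ι : Type*} {x : ι → E} {I : Finset ι} {y : E} {t t' : ℝ}
    (h : Joins x I y t) (ht : t ≤ t') : Joins x I y t' := by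
  rcases h with ⟨hI, h0⟩ | ⟨P, hP⟩
  · exact .inl ⟨hI, h0.trans ht⟩
  · exact .inr ⟨P, hP.mono ht⟩

theorem Joins.union {ι : Type*} [DecidableEq ι] {x : ι → E} {I J : Finset ι} {y : E} {t t' : ℝ}
    (hd : Disjoint I J) (h : Joins x I y t) (h' : Joins x J y t') :
    Joins x (I ∪ J) y (t + t') := by
  rcases h with ⟨rfl, ht⟩ | ⟨P, hP⟩
  · rw [Finset.empty_union]
    exact h'.mono (by linarith)
  rcases h' with ⟨rfl, ht⟩ | ⟨Q, hQ⟩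
  · rw [Finset.union_empty]
    exact .inr ⟨P, hP.mono (by linarith)⟩
  rw [← Finset.disjUnion_eq_union I J hd]
  exact .inr ⟨.add hd P Q, y, t, t', hP, hQ, by simp⟩

/-- In a rooted tree given by a parent map, the networks at the vertices can be moved along the
edges to the root. The index `i` starts at the vertex `anc i`. -/
theorem joins_univ_of_parent {ι V : Type*} [Fintype ι] [DecidableEq ι] [DecidableEq V] (x : ι → E)
    (d : V → ℕ) (par : V → V) (pos : V → E) (r : V) (S : Finset V) (hr : r ∉ S)
    (hpar : ∀ v ∈ S, par v ∈ insert r S ∧ d (par v) < d v) (anc : ι → V) (t : V → ℝ)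
    (hanc : ∀ i, anc i ∈ insert r S)
    (h : ∀ v ∈ insert r S, Joins x (Finset.univ.filter (anc · = v)) (pos v) (t v)) :
    Joins x Finset.univ (pos r) (∑ v ∈ insert r S, t v + ∑ v ∈ S, ‖pos v - pos (par v)‖) := by
  -- A vertex `a` of maximal depth is nobody's parent. It is pruned: its network moves along its
  -- edge to the parent `u`, and its indices now start at `u`.
  induction S using Finset.induction_on_max_value d generalizing anc t with
  | empty =>
    have h₀ := h r (Finset.mem_insert_self _ _)
    rw [Finset.filter_true_of_mem fun i _ => by simpa using hanc i] at h₀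
    simpa using h₀
  | insert a S ha hmax ih =>
    obtain ⟨hpa, hda⟩ := hpar a (Finset.mem_insert_self _ _)
    obtain ⟨hra, hrS⟩ : r ≠ a ∧ r ∉ S := by
      simpa only [Finset.mem_insert, not_or] using hr
    set u := par a with hu
    have hua : u ≠ a := fun e => by rw [e] at hda; exact lt_irrefl _ hda
    have haS : a ∉ insert r S := by simp [ha, hra.symm]
    have hins : insert r (insert a S) = insert a (insert r S) := Finset.insert_comm _ _ _
    rw [hins] at hpa hanc h hpar
    have huS : u ∈ insert r S := Finset.mem_of_mem_insert_of_ne hpa hua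
    have key := ih hrS
      (fun v hv => by
        obtain ⟨h₁, h₂⟩ := hpar v (Finset.mem_insert_of_mem hv)
        refine ⟨Finset.mem_of_mem_insert_of_ne h₁ fun e => ?_, h₂⟩
        rw [e] at h₂
        exact absurd (hmax v hv) (not_le.2 h₂))
      (fun i => if anc i = a then u else anc i)
      (fun v => t v + if v = u then t a + ‖pos a - pos u‖ else 0)
      (fun i => by
        split_ifs with hi
        · exact huS
        · exact Finset.mem_of_mem_insert_of_ne (hanc i) hi)
      (fun v hv => by
        have hva : v ≠ a := fun e => haS (e ▸ hv)
        have hv' := h v (Finset.mem_insert_of_mem hv)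
        by_cases hvu : v = u
        · rw [if_pos hvu]
          have hA := (h a (Finset.mem_insert_self _ _)).move (pos u)
          rw [← hvu] at hA ⊢
          have hdisj : Disjoint (Finset.univ.filter (anc · = v)) (Finset.univ.filter (anc · = a)) :=
            Finset.disjoint_filter.2 fun i _ h₁ h₂ => hva (h₁.symm.trans h₂)
          convert hv'.union hdisj hA using 1
          ext i
          simp only [Finset.mem_filter, Finset.mem_univ, true_and, Finset.mem_union]
          split_ifs with hi <;> simp [hi]
        · rw [if_neg hvu, add_zero]
          convert hv' using 1
          ext i
          simp only [Finset.mem_filter, Finset.mem_univ, true_and]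
          split_ifs with hi
          · simp [hi, Ne.symm hvu, hva.symm]
          · rfl)
    rw [hins, Finset.sum_insert haS, Finset.sum_insert ha]
    rw [Finset.sum_add_distrib, Finset.sum_ite_eq', if_pos huS] at key
    exact key.mono (by linarith)

theorem SimpleGraph.Connected.exists_adj_dist_lt {V : Type*} {G : SimpleGraph V}
    (hG : G.Connected) {v r : V} (hv : v ≠ r) : ∃ u, G.Adj v u ∧ G.dist u r < G.dist v r := by
  obtain ⟨w, hw⟩ := hG.exists_walk_length_eq_dist v r
  cases w with
  | nil => exact absurd rfl hv
  | cons hadj w =>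
    refine ⟨_, hadj, ?_⟩
    rw [← hw, SimpleGraph.Walk.length_cons]
    exact Nat.lt_succ_of_le (SimpleGraph.dist_le w)

theorem SteinerTree.joins {ι : Type*} [Fintype ι] {N : Finset E} (T : SteinerTree N) {o : E}
    (ho : o ∈ N) {q : ι → E} (hq : Function.Injective q) (hqN : ∀ i, q i ∈ N) :
    Joins (fun i => q i - o) Finset.univ 0 T.length := by
  classical
  let r : T.verts := ⟨o, T.subset_verts ho⟩
  have hex : ∀ v, ∃ u, v ≠ r → T.graph.Adj v u ∧ T.graph.dist u r < T.graph.dist v r := fun v => by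
    by_cases hv : v = r
    · exact ⟨v, fun h => absurd hv h⟩
    · obtain ⟨u, hu⟩ := T.isTree.connected.exists_adj_dist_lt hv
      exact ⟨u, fun _ => hu⟩
  choose par hpar using hex
  have hJ := joins_univ_of_parent (fun i => q i - o) (T.graph.dist · r) par
    (fun v : T.verts => (v : E) - o) r (Finset.univ.erase r) (Finset.notMem_erase _ _)
    (fun v hv => ⟨by rw [Finset.insert_erase (Finset.mem_univ _)]; exact Finset.mem_univ _,
      (hpar v (Finset.ne_of_mem_erase hv)).2⟩)
    (fun i => ⟨q i, T.subset_verts (hqN i)⟩) 0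
    (fun i => by rw [Finset.insert_erase (Finset.mem_univ _)]; exact Finset.mem_univ _)
    (fun v _ => by
      by_cases hv : ∃ i, q i = v
      · obtain ⟨i, hi⟩ := hv
        have : (Finset.univ.filter fun j => (⟨q j, T.subset_verts (hqN j)⟩ : T.verts) = v) = {i} := by
          ext j
          simp only [Finset.mem_filter, Finset.mem_univ, true_and, Finset.mem_singleton,
            Subtype.ext_iff, ← hi]
          exact hq.eq_iff
        rw [this]
        exact .inr ⟨.operand i, by simp [Parenthesization.Connects, hi]⟩
      · refine .inl ⟨Finset.filter_false_of_mem fun i _ he => hv ⟨i, congrArg Subtype.val he⟩, le_rfl⟩)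
  simp only [sub_self, Pi.zero_apply, Finset.sum_const_zero, zero_add, sub_sub_sub_cancel_right,
    r] at hJ
  refine hJ.mono ?_
  rw [SteinerTree.length]
  -- Two vertices cannot be each other's parent, since the distance to the root strictly drops; so
  -- no edge is charged twice.
  have hinj : Set.InjOn (fun v => s(v, par v)) (Finset.univ.erase r : Finset T.verts) := by
    intro v hv w hw he
    have hv := (hpar v (Finset.ne_of_mem_erase hv)).2
    have hw := (hpar w (Finset.ne_of_mem_erase hw)).2
    rcases Sym2.eq_iff.1 he with ⟨h, -⟩ | ⟨h₁, h₂⟩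
    · exact h
    · rw [h₂] at hv
      rw [← h₁] at hw
      exact absurd hv hw.asymm
  refine (Finset.sum_image (f := edgeLength) hinj).symm.le.trans
    (Finset.sum_le_sum_of_subset_of_nonneg (fun e he => ?_) fun e _ _ => edgeLength_nonneg e)
  obtain ⟨v, hv, rfl⟩ := Finset.mem_image.1 he
  exact SimpleGraph.mem_edgeFinset.2 (hpar v (Finset.ne_of_mem_erase hv)).1

theorem SteinerTree.length_star {k : ℕ} (p : Fin (k + 1) → E) (hp : Function.Injective p) :
    (SteinerTree.star (Finset.univ.map ⟨p, hp⟩) (p 0)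
      (Finset.mem_map_of_mem ⟨p, hp⟩ (Finset.mem_univ 0))).length =
      ∑ i : Fin k, ‖p i.succ - p 0‖ := by
  classical
  let N := Finset.univ.map ⟨p, hp⟩
  let q : Fin (k + 1) → N := fun i => ⟨p i, Finset.mem_map_of_mem ⟨p, hp⟩ (Finset.mem_univ i)⟩
  have hq : Function.Injective q := fun i j h => hp (congrArg Subtype.val h)
  have hq0 : ∀ i : Fin k, q 0 ≠ q i.succ := fun i h => (Fin.succ_ne_zero i) (hq h).symm
  have hsurj : ∀ v : N, v ≠ q 0 → ∃ i : Fin k, q i.succ = v := by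
    rintro ⟨v, hv⟩ hne
    obtain ⟨i, -, rfl⟩ := Finset.mem_map.1 hv
    obtain ⟨j, rfl⟩ := Fin.exists_succ_eq.2 fun h : i = 0 => hne (by subst h; rfl)
    exact ⟨j, rfl⟩
  rw [SteinerTree.length_eq_sum (S := (SimpleGraph.starGraph (q 0)).edgeFinset) _
    fun e => SimpleGraph.mem_edgeFinset]
  symm
  refine Finset.sum_bij (fun i _ => s(q i.succ, q 0)) (fun i _ => ?_) (fun i _ j _ h => ?_)
    (fun e he => ?_) fun i _ => rfl
  · exact SimpleGraph.mem_edgeFinset.2 (SimpleGraph.starGraph_center_adj' (hq0 i))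
  · exact Fin.succ_injective _ (hq (Sym2.congr_left.1 h))
  · induction e with
    | _ v w =>
      obtain ⟨hne, rfl | rfl⟩ := SimpleGraph.starGraph_adj.1 (SimpleGraph.mem_edgeFinset.1 he)
      · obtain ⟨i, rfl⟩ := hsurj w hne.symm
        exact ⟨i, Finset.mem_univ _, Sym2.eq_swap⟩
      · obtain ⟨i, rfl⟩ := hsurj v hne
        exact ⟨i, Finset.mem_univ _, rfl⟩

end Networks

/-! ### The equivalence. -/

theorem mainTheorem4 {E : Type*} [NormedAddCommGroup E] [NormedSpace ℝ E]
    [FiniteDimensional ℝ E] (k : ℕ) (p : Fin (k + 1) → E) (hp : Function.Injective p) :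
    (SteinerTree.star (Finset.univ.map ⟨p, hp⟩) (p 0)
        (Finset.mem_map_of_mem ⟨p, hp⟩ (Finset.mem_univ 0))).IsMinimal ↔
      ∀ P : Parenthesization (Finset.univ : Finset (Fin k)),
        (P.eval fun i => normingFunctionals (p i.succ - p 0)).Nonempty := by
  have hx : ∀ i : Fin k, p i.succ - p 0 ≠ 0 := fun i =>
    sub_ne_zero.2 fun h => Fin.succ_ne_zero i (hp h)
  constructor
  · intro hmin P
    refine P.eval_nonempty_of_forall_connects hx fun t ht => ?_
    obtain ⟨F, hF, hle⟩ := ht.exists_reachable (p 0)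
    obtain ⟨T, hT⟩ := exists_steinerTree_length_le F (N := Finset.univ.map ⟨p, hp⟩) (p 0)
      fun v hv => by
        obtain ⟨i, -, rfl⟩ := Finset.mem_map.1 hv
        refine Fin.cases ?_ (fun j => ?_) i
        · exact SimpleGraph.Reachable.refl _
        · simpa using hF j (Finset.mem_univ j)
    rw [← SteinerTree.length_star p hp]
    exact (hmin T).trans (hT.trans hle)
  · intro h T
    rw [SteinerTree.length_star p hp]
    rcases T.joins (Finset.mem_map_of_mem ⟨p, hp⟩ (Finset.mem_univ 0)) (q := fun i : Fin k => p i.succ)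
      (hp.comp (Fin.succ_injective k)) (fun i => Finset.mem_map_of_mem ⟨p, hp⟩ (Finset.mem_univ _))
      with ⟨hI, hT⟩ | ⟨P, hP⟩
    -- The case k = 0: there is no parenthesization, and the star has length 0.
    · rw [hI, Finset.sum_empty]
      exact hT
    · obtain ⟨χ, hχ⟩ := h P
      simpa using hP.sub_le hx hχ
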